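/- Let $m\ge 0$ and let $\mathbb{P}$ be a probability measure on $\mathbb{R}\times\mathbb{R}^m$ with bounded support and with a density with respect to Lebesgue measure. Let $(b_1,\mathbf r_1),(b_2,\mathbf r_2),\dots$ be i.i.d. samples from $\mathbb{P}$, and let $\mathcal S_n$ consist of the first $n$ of them. Let $(c_n)_{n\ge1}$ be positive reals with $c_n\downarrow 0$ and $\lim_{n\to\infty} n\,c_n^{m+1}=\infty$. For every $n\ge 1$ let $\mathbf x(c_n,\mathcal S_n)$ be a Lasso solution, that is, any minimizer over $\mathbf x\in\mathbb{R}^m$ of $$\sqrt{\frac1n\sum_{i=1}^n\bigl(b_i-\mathbf r_i^\top\mathbf x\bigr)^2}+c_n\|\mathbf x\|_1 ,$$ and suppose that almost surely there is a constant $H$ (possibly depending on the realization of the samples) such that $\|\mathbf x(c_n,\mathcal S_n)\|_2\le H$ for all $n\ge1$. Then the true risk $\mathbf x\mapsto\sqrt{\int (b-\mathbf r^\top\mathbf x)^2\,d\mathbb{P}(b,\mathbf r)}$ has a minimizer over $\mathbb{R}^m$, and for every minimizer $\mathbf x(\mathbb{P})$, $$\lim_{n\to\infty}\sqrt{\int \bigl(b-\mathbf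 r^\top\mathbf x(c_n,\mathcal S_n)\bigr)^2\,d\mathbb{P}(b,\mathbf r)}=\sqrt{\int \bigl(b-\mathbf r^\top\mathbf x(\mathbb{P})\bigr)^2\,d\mathbb{P}(b,\mathbf r)}\qquad\text{almost surely.}$$ -/

import Mathlib

open MeasureTheory ProbabilityTheory Filter Topology

/-- Observations `z = (b, r)`: a response `b ∈ ℝ` and a feature vector `r ∈ ℝᵐ`. -/
abbrev Obs (m : ℕ) : Type := ℝ × EuclideanSpace ℝ (Fin m)

/-- The residual `b - rᵀ x` of the linear predictor `x` at the observation `z = (b, r)`. -/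
noncomputable def predResidual {m : ℕ} (z : Obs m) (x : EuclideanSpace ℝ (Fin m)) : ℝ :=
  z.1 - ∑ j, z.2 j * x j

/-- The Lasso objective
`√((1/n) ∑ᵢ (bᵢ - rᵢᵀ x)²) + c ‖x‖₁` for the `n` observations `S` and the parameter `c`. -/
noncomputable def lassoObjective {m n : ℕ} (c : ℝ) (S : Fin n → Obs m)
    (x : EuclideanSpace ℝ (Fin m)) : ℝ :=
  √((1 / (n : ℝ)) * ∑ i, predResidual (S i) x ^ 2) + c * ∑ j, |x j|

/-- `x` is a Lasso solution: a (global) minimizer of the Lasso objective over `ℝᵐ`. -/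
def IsLassoSolution {m n : ℕ} (c : ℝ) (S : Fin n → Obs m)
    (x : EuclideanSpace ℝ (Fin m)) : Prop :=
  ∀ y : EuclideanSpace ℝ (Fin m), lassoObjective c S x ≤ lassoObjective c S y

/-- The true risk `√(∫ (b - rᵀ x)² dP(b, r))` of the predictor `x`. -/
noncomputable def trueRisk {m : ℕ} (P : Measure (Obs m)) (x : EuclideanSpace ℝ (Fin m)) : ℝ :=
  √(∫ z, predResidual z x ^ 2 ∂P)

/-- `x` is a true optimal solution: a (global) minimizer of the true risk over `ℝᵐ`. -/
def IsOptimalSolution {m : ℕ} (P : Measure (Obs m)) (x : EuclideanSpace ℝ (Fin m)) : Prop :=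
  ∀ y : EuclideanSpace ℝ (Fin m), trueRisk P x ≤ trueRisk P y

/-! The squared residual is a quadratic form in the coefficient vector `(1, -x)`, and its matrix
consists of products of coordinates of `(b, r)`. Empirical and true squared risks are thus the same
polynomial in `x`, with empirical or true second moments as coefficients. The strong law for these
finitely many moments makes the two risks close uniformly on bounded sets of predictors, which
covers the data-dependent Lasso solutions. Comparing the Lasso objective at `x n` and at the optimum
`xP` then squeezes the true risk of `x n`, since the penalty at `xP` vanishes with `c n`. -/

/-- The coordinates of an observation `(b, r)`, with `b` first. -/
noncomputable def obsCoord {m : ℕ} (k : Option (Fin m)) (z : Obs m) : ℝ :=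
  k.elim z.1 fun j => z.2 j

/-- The coefficients with which the coordinates of an observation enter the residual. -/
noncomputable def residualCoeff {m : ℕ} (x : EuclideanSpace ℝ (Fin m)) (k : Option (Fin m)) : ℝ :=
  k.elim 1 fun j => -x j

theorem predResidual_eq_sum {m : ℕ} (z : Obs m) (x : EuclideanSpace ℝ (Fin m)) :
    predResidual z x = ∑ k, obsCoord k z * residualCoeff x k := by
  simp [predResidual, obsCoord, residualCoeff, Fintype.sum_option, sub_eq_add_neg]

theorem predResidual_sq_eq_sum {m : ℕ} (z : Obs m) (x : EuclideanSpace ℝ (Fin m)) :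
    predResidual z x ^ 2 =
      ∑ k, ∑ l, (obsCoord k z * obsCoord l z) * (residualCoeff x k * residualCoeff x l) := by
  rw [predResidual_eq_sum, sq, Finset.sum_mul_sum]
  refine Finset.sum_congr rfl fun k _ => Finset.sum_congr rfl fun l _ => ?_
  ring

theorem continuous_obsCoord {m : ℕ} (k : Option (Fin m)) : Continuous (obsCoord k) := by
  cases k with
  | none => exact continuous_fst
  | some j => exact (EuclideanSpace.proj (𝕜 := ℝ) j).continuous.comp continuous_snd

theorem abs_obsCoord_le_norm {m : ℕ} (k : Option (Fin m)) (z : Obs m) : |obsCoord k z| ≤ ‖z‖ := by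
  cases k with
  | none => exact norm_fst_le z
  | some j => exact (PiLp.norm_apply_le z.2 j).trans (norm_snd_le z)

theorem abs_residualCoeff_le {m : ℕ} (x : EuclideanSpace ℝ (Fin m)) (k : Option (Fin m)) :
    |residualCoeff x k| ≤ 1 + ‖x‖ := by
  cases k with
  | none => simp [residualCoeff]
  | some j =>
    have := PiLp.norm_apply_le x j
    rw [Real.norm_eq_abs] at this
    simp only [residualCoeff, Option.elim, abs_neg]
    linarith

theorem memLp_obsCoord {m : ℕ} {P : Measure (Obs m)} [IsFiniteMeasure P]
    (hP : Bornology.IsBounded P.support) (p : ENNReal) (k : Option (Fin m)) :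
    MemLp (obsCoord k) p P := by
  obtain ⟨B, hB⟩ := hP.exists_norm_le
  refine MemLp.of_bound (continuous_obsCoord k).aestronglyMeasurable B ?_
  filter_upwards [P.support_mem_ae] with z hz
  exact (abs_obsCoord_le_norm k z).trans (hB z hz)

theorem integrable_obsCoord_mul {m : ℕ} {P : Measure (Obs m)} [IsFiniteMeasure P]
    (hP : Bornology.IsBounded P.support) (k l : Option (Fin m)) :
    Integrable (fun z => obsCoord k z * obsCoord l z) P :=
  (memLp_obsCoord hP 2 k).integrable_mul (memLp_obsCoord hP 2 l)

theorem integral_predResidual_sq {m : ℕ} {P : Measure (Obs m)} [IsFiniteMeasure P]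
    (hP : Bornology.IsBounded P.support) (x : EuclideanSpace ℝ (Fin m)) :
    ∫ z, predResidual z x ^ 2 ∂P =
      ∑ k, ∑ l, (∫ z, obsCoord k z * obsCoord l z ∂P) *
        (residualCoeff x k * residualCoeff x l) := by
  have hi := fun k l => (integrable_obsCoord_mul hP k l).mul_const
    (residualCoeff x k * residualCoeff x l)
  simp_rw [predResidual_sq_eq_sum]
  rw [integral_finsetSum _ fun k _ => integrable_finsetSum _ fun l _ => hi k l]
  refine Finset.sum_congr rfl fun k _ => ?_
  rw [integral_finsetSum _ fun l _ => hi k l]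
  exact Finset.sum_congr rfl fun l _ => integral_mul_const _ _

theorem mean_predResidual_sq {m n : ℕ} (S : ℕ → Obs m) (x : EuclideanSpace ℝ (Fin m)) :
    (1 / (n : ℝ)) * ∑ i : Fin n, predResidual (S i) x ^ 2 =
      ∑ k, ∑ l, ((∑ i ∈ Finset.range n, obsCoord k (S i) * obsCoord l (S i)) / n) *
        (residualCoeff x k * residualCoeff x l) := by
  rw [Fin.sum_univ_eq_sum_range fun i => predResidual (S i) x ^ 2]
  simp_rw [predResidual_sq_eq_sum]
  rw [Finset.sum_comm, Finset.mul_sum]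
  refine Finset.sum_congr rfl fun k _ => ?_
  rw [Finset.sum_comm, Finset.mul_sum]
  refine Finset.sum_congr rfl fun l _ => ?_
  rw [← Finset.sum_mul]
  ring

/-- The strong law of large numbers for the second moments of the observations. -/
theorem ae_tendsto_moments {m : ℕ} {P : Measure (Obs m)} [IsFiniteMeasure P]
    (hP : Bornology.IsBounded P.support) {Ω : Type*} [MeasurableSpace Ω] {μ : Measure Ω}
    {Z : ℕ → Ω → Obs m} (hZ_law : ∀ i, HasLaw (Z i) P μ) (hZ_indep : iIndepFun Z μ) :
    ∀ᵐ ω ∂μ, ∀ k l, Tendsto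
      (fun n : ℕ => (∑ i ∈ Finset.range n, obsCoord k (Z i ω) * obsCoord l (Z i ω)) / n) atTop
      (𝓝 (∫ z, obsCoord k z * obsCoord l z ∂P)) := by
  refine ae_all_iff.2 fun k => ae_all_iff.2 fun l => ?_
  have hc : Continuous fun z : Obs m => obsCoord k z * obsCoord l z :=
    (continuous_obsCoord k).mul (continuous_obsCoord l)
  have hint : Integrable ((fun z => obsCoord k z * obsCoord l z) ∘ Z 0) μ := by
    refine Integrable.comp_aemeasurable ?_ (hZ_law 0).aemeasurable
    rw [(hZ_law 0).map_eq]
    exact integrable_obsCoord_mul hP k l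
  have h := strong_law_ae_real (fun i => (fun z => obsCoord k z * obsCoord l z) ∘ Z i) hint
    (fun i j hij => (hZ_indep.indepFun hij).comp hc.measurable hc.measurable)
    (fun i => ((hZ_law i).identDistrib (hZ_law 0)).comp hc.measurable)
  rw [(hZ_law 0).integral_comp hc.aestronglyMeasurable] at h
  exact h

/-- The second moment sums at bounded predictors differ by a null sequence if the moments do. -/
theorem tendsto_moment_sum_sub {m : ℕ} {M : ℕ → Option (Fin m) → Option (Fin m) → ℝ}
    {M' : Option (Fin m) → Option (Fin m) → ℝ}
    (hM : ∀ k l, Tendsto (fun n => M n k l) atTop (𝓝 (M' k l)))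
    {x : ℕ → EuclideanSpace ℝ (Fin m)} {H : ℝ} (hx : ∀ n, 1 ≤ n → ‖x n‖ ≤ H) :
    Tendsto (fun n => ∑ k, ∑ l, M n k l * (residualCoeff (x n) k * residualCoeff (x n) l) -
      ∑ k, ∑ l, M' k l * (residualCoeff (x n) k * residualCoeff (x n) l)) atTop (𝓝 0) := by
  simp_rw [← Finset.sum_sub_distrib, ← sub_mul]
  rw [show (0 : ℝ) = ∑ _k : Option (Fin m), ∑ _l : Option (Fin m), 0 by simp]
  refine tendsto_finsetSum _ fun k _ => tendsto_finsetSum _ fun l _ => ?_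
  refine bdd_le_mul_tendsto_zero' ((1 + H) * (1 + H)) ?_
    (tendsto_sub_nhds_zero_iff.2 (hM k l)) |>.congr fun n => mul_comm _ _
  filter_upwards [eventually_ge_atTop 1] with n hn
  have hk := (abs_residualCoeff_le (x n) k).trans (add_le_add_right (hx n hn) 1)
  have hl := (abs_residualCoeff_le (x n) l).trans (add_le_add_right (hx n hn) 1)
  rw [abs_mul]
  exact mul_le_mul hk hl (abs_nonneg _) ((abs_nonneg _).trans hk)

/-- The true risk is the `L²(P)` distance from `b` to a linear predictor. These predictors form a
finite-dimensional subspace, so the orthogonal projection of `b` attains the minimum, even if the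
moment matrix is singular. -/
theorem exists_isOptimalSolution {m : ℕ} {P : Measure (Obs m)} [IsFiniteMeasure P]
    (hP : Bornology.IsBounded P.support) : ∃ xP, IsOptimalSolution P xP := by
  have hb : MemLp (fun z : Obs m => z.1) 2 P := memLp_obsCoord hP 2 none
  have hr (x : EuclideanSpace ℝ (Fin m)) : MemLp (fun z : Obs m => ∑ j, z.2 j * x j) 2 P :=
    memLp_finsetSum _ fun j _ => (memLp_obsCoord hP 2 (some j)).mul_const (x j)
  let L : EuclideanSpace ℝ (Fin m) →ₗ[ℝ] Lp ℝ 2 P :=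
    { toFun := fun x => (hr x).toLp
      map_add' := fun x y => by
        rw [← MemLp.toLp_add]
        exact MemLp.toLp_congr _ _ (.of_forall fun z => by
          simp [mul_add, Finset.sum_add_distrib])
      map_smul' := fun a x => by
        rw [RingHom.id_apply, ← MemLp.toLp_const_smul]
        exact MemLp.toLp_congr _ _ (.of_forall fun z => by
          simp [Finset.mul_sum, mul_left_comm]) }
  have hL (x) : trueRisk P x = ‖hb.toLp - L x‖ := by
    rw [trueRisk, Real.sqrt_eq_iff_mul_self_eq (integral_nonneg fun z => sq_nonneg _)
      (norm_nonneg _), ← real_inner_self_eq_norm_mul_norm, L2.inner_def]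
    refine integral_congr_ae ?_
    have h : hb.toLp - L x = (hb.sub (hr x)).toLp := (MemLp.toLp_sub hb (hr x)).symm
    rw [h]
    filter_upwards [(hb.sub (hr x)).coeFn_toLp] with z hz
    simp [hz, predResidual, sq]
  obtain ⟨xP, hxP⟩ := (LinearMap.range L).starProjection_apply_mem hb.toLp
  refine ⟨xP, fun y => ?_⟩
  rw [hL, hL, hxP, Submodule.starProjection_minimal]
  exact ciInf_le ⟨0, by rintro _ ⟨w, rfl⟩; exact norm_nonneg _⟩
    (⟨L y, LinearMap.mem_range_self L y⟩ : LinearMap.range L)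

theorem theorem7 {m : ℕ}
    -- the generating distribution: a probability with bounded support and a density
    (P : Measure (Obs m)) [IsProbabilityMeasure P]
    (hP_supp : Bornology.IsBounded P.support)
    (hP_dens : ∃ f : Obs m → ENNReal, Measurable f ∧ P = volume.withDensity f)
    -- i.i.d. observations `Z 0, Z 1, …` with law `P`
    {Ω : Type*} [MeasurableSpace Ω] (μ : Measure Ω) [IsProbabilityMeasure μ]
    (Z : ℕ → Ω → Obs m) (hZ_law : ∀ i, HasLaw (Z i) P μ) (hZ_indep : iIndepFun Z μ)
    -- the parameters `c 1, c 2, …`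
    (c : ℕ → ℝ) (hc_pos : ∀ n, 1 ≤ n → 0 < c n) (hc_anti : AntitoneOn c (Set.Ici 1))
    (hc_lim : Tendsto c atTop (𝓝 0))
    (hc_rate : Tendsto (fun n : ℕ => (n : ℝ) * c n ^ (m + 1)) atTop atTop)
    -- `x n` is any Lasso solution for the first `n` observations; these stay bounded
    (x : ℕ → Ω → EuclideanSpace ℝ (Fin m))
    (hx : ∀ᵐ ω ∂μ, ∀ n, 1 ≤ n →
      IsLassoSolution (c n) (fun i : Fin n => Z i ω) (x n ω))
    (hx_bdd : ∀ᵐ ω ∂μ, ∃ H : ℝ, ∀ n, 1 ≤ n → ‖x n ω‖ ≤ H) :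
    (∃ xP, IsOptimalSolution P xP) ∧
    ∀ xP, IsOptimalSolution P xP →
      ∀ᵐ ω ∂μ, Tendsto (fun n => trueRisk P (x n ω)) atTop (𝓝 (trueRisk P xP)) := by

  refine ⟨exists_isOptimalSolution hP_supp, fun xP hxP => ?_⟩
  filter_upwards [ae_tendsto_moments hP_supp hZ_law hZ_indep, hx, hx_bdd] with ω hM hxω ⟨H, hH⟩
  have hdiff := tendsto_moment_sum_sub hM hH
  -- The constant sequence `xP` gives convergence of its empirical risk.
  have hopt := tendsto_moment_sum_sub hM (x := fun _ => xP) (H := ‖xP‖) fun _ _ => le_rfl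
  simp_rw [← integral_predResidual_sq hP_supp,
    ← mean_predResidual_sq (fun i => Z i ω)] at hdiff hopt
  rw [tendsto_sub_nhds_zero_iff] at hopt
  -- The bound is the Lasso objective at `xP` plus the error of passing from empirical to true risk
  -- at `x n`.
  have hupper := (hopt.sqrt.add (hc_lim.mul_const (∑ j, |xP j|))).add hdiff.abs.sqrt
  rw [abs_zero, Real.sqrt_zero, zero_mul, add_zero, add_zero] at hupper
  refine tendsto_of_tendsto_of_tendsto_of_le_of_le' tendsto_const_nhds hupper
    (.of_forall fun n => hxP (x n ω)) ?_
  filter_upwards [eventually_ge_atTop 1] with n hn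
  have hmin := hxω n hn xP
  have hpen : 0 ≤ c n * ∑ j, |x n ω j| :=
    mul_nonneg (hc_pos n hn).le (Finset.sum_nonneg fun j _ => abs_nonneg _)
  unfold lassoObjective at hmin
  set a := (1 / (n : ℝ)) * ∑ i : Fin n, predResidual (Z i ω) (x n ω) ^ 2
  set b := ∫ z, predResidual z (x n ω) ^ 2 ∂P with hb
  have ha : 0 ≤ a := by positivity
  -- Subadditivity of the square root, applied to `b ≤ a + |a - b|`.
  have hab : √b ≤ √a + √|a - b| := by
    refine Real.sqrt_le_iff.2 ⟨by positivity, ?_⟩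
    rw [add_sq, Real.sq_sqrt ha, Real.sq_sqrt (abs_nonneg _)]
    nlinarith [neg_abs_le (a - b), Real.sqrt_nonneg a, Real.sqrt_nonneg |a - b|]
  rw [trueRisk, ← hb]
  linarith
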